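/- Let $G=(V,E)$ be a simple undirected graph, finite or infinite, whose vertex set $V$ may have any cardinality. Suppose that $G$ is rayless: there is no sequence $v_0,v_1,v_2,\dots$ of pairwise distinct vertices of $G$ such that $v_nv_{n+1}\in E$ for every $n\ge 0$. Then $G$ has an unfriendly partition: there is a function $\pi:V\to\{0,1\}$ such that for every vertex $x\in V$ $$|\{y\in V : xy\in E,\ \pi(y)=\pi(x)\}|\ \le\ |\{y\in V : xy\in E,\ \pi(y)\neq\pi(x)\}|,$$ where $|\cdot|$ denotes cardinality (possibly infinite). That is, every vertex has at least as many neighbours in the other class as in its own. -/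

import Mathlib

namespace SimpleGraph

universe u

variable {V : Type u}

/-- A ray of `G`: a one-way infinite path, that is, a sequence of distinct vertices indexed by `ℕ`
in which consecutive vertices are adjacent in `G`. -/
structure Ray (G : SimpleGraph V) where
  /-- The `n`-th vertex of the ray. -/
  vertex : ℕ → V
  injective : Function.Injective vertex
  adj : ∀ n, G.Adj (vertex n) (vertex (n + 1))

/-- A graph is rayless if it contains no ray. -/
def IsRayless (G : SimpleGraph V) : Prop := IsEmpty G.Ray

/-- The friends of `x` in the partition `π`: the neighbours of `x` in the class of `x`. -/
def friends (G : SimpleGraph V) (π : V → Fin 2) (x : V) : Set V :=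
  {y | G.Adj x y ∧ π y = π x}

/-- The opponents of `x` in the partition `π`: the neighbours of `x` in the other class. -/
def opponents (G : SimpleGraph V) (π : V → Fin 2) (x : V) : Set V :=
  {y | G.Adj x y ∧ π y ≠ π x}

/-- A vertex is happy in `π` if it has at least as many opponents as friends, where the numbers of
opponents and friends are (possibly infinite) cardinals. -/
def IsHappy (G : SimpleGraph V) (π : V → Fin 2) (x : V) : Prop :=
  Cardinal.mk (G.friends π x) ≤ Cardinal.mk (G.opponents π x)

/-- A partition is unfriendly if every vertex is happy in it. -/
def IsUnfriendly (G : SimpleGraph V) (π : V → Fin 2) : Prop :=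
  ∀ x : V, G.IsHappy π x

end SimpleGraph

/-!
Call a set `B` of vertices *adjustable* if every colouring of `G` can be changed inside any
prescribed `A ⊆ B` so that all vertices of `A` become happy, with all vertices outside `A` keeping
their colours (`IsAdjustable`). The theorem says in particular that the whole vertex set of a
rayless graph is adjustable.

Raylessness serves as an induction principle (`IsRayless.wellFounded_pathStep`): a statement about
the component of `v` in `G[X]` may be assumed for the components of `G[X \ {v}]` that contain a
neighbour of `v`, since an infinite descent would trace out a ray. Different components can be
adjusted independently (`isAdjustable_of_reach`), so it only remains to see that adjustability
survives the addition of a single vertex `v` (`IsRayless.isAdjustable_insert`).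

Suppose that all vertices of `A` but `v` have been made happy.
* If `v` has finite degree, look at the vertices of finite degree reachable from `v` through such
  vertices. They are finitely many by König's lemma, so a locally optimal cut makes those of
  them in `A` happy, and a change of finitely many colours does no harm to the vertices of infinite degree.
* If `v` has infinite degree and is unhappy, it has fewer opponents than its degree. Switch the
  colour of `v`. Its former friends do not mind, and only its former opponents may become unhappy.
  Call a degree small if it is below the least regular cardinal `c` exceeding the number of
  opponents. The set `W` of vertices reachable from the opponents through vertices of small degree
  has fewer than `c` elements, by a form of König's lemma (`IsRayless.mk_reach_lt`). The vertices of
  small degree in `W ∩ A` are readjusted, with all other colours prescribed, which is possible because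
  `B` is adjustable with respect to arbitrary subsets. Vertices of degree at least `c`, among them
  `v`, are not affected by fewer than `c` changes, and the remaining vertices of small degree in `A`
  have no neighbour among the readjusted ones.
-/

namespace SimpleGraph

open Cardinal Set

variable {V : Type u} {G : SimpleGraph V}

/-! ### Induction along paths -/

/-- One step along a path of `G`: from the state `(X, v)` the path moves from `v` to a neighbour
in `X \ {v}`, and only `X \ {v}` remains available. -/
def PathStep (G : SimpleGraph V) (q p : Set V × V) : Prop :=
  q.1 = p.1 \ {p.2} ∧ q.2 ∈ q.1 ∧ G.Adj p.2 q.2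

theorem IsRayless.wellFounded_pathStep (hG : G.IsRayless) : WellFounded G.PathStep := by
  rw [wellFounded_iff_isEmpty_descending_chain]
  refine ⟨fun ⟨f, hf⟩ ↦ hG.false ⟨fun n ↦ (f n).2, ?_, fun n ↦ (hf n).2.2⟩⟩
  have hanti : Antitone fun n ↦ (f n).1 :=
    antitone_nat_of_succ_le fun n ↦ by rw [(hf n).1]; exact sdiff_subset
  refine Function.Injective.of_lt_imp_ne fun m n hmn h ↦ ?_
  obtain ⟨k, rfl⟩ := Nat.exists_eq_add_of_lt hmn
  have h1 := hanti (show m + 1 ≤ m + k + 1 by omega) (hf (m + k)).2.1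
  simp only [(hf m).1] at h1
  exact h1.2 h.symm

/-- The set of vertices that can be reached from `v` by steps of the relation `T` into `X`; the
start `v` itself need not lie in `X`. For `v ∈ X`, the set `reach G.Adj X v` is the component of
`v` in `G[X]`. -/
def reach (T : V → V → Prop) (X : Set V) (v : V) : Set V :=
  {w | Relation.ReflTransGen (fun a b ↦ T a b ∧ b ∈ X) v w}

theorem mem_reach_self (T : V → V → Prop) (X : Set V) (v : V) : v ∈ reach T X v :=
  Relation.ReflTransGen.refl

theorem reach_subset (T : V → V → Prop) {X : Set V} {v : V} (hv : v ∈ X) : reach T X v ⊆ X := by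
  intro w hw
  cases hw with
  | refl => exact hv
  | tail _ h => exact h.2

/-- After the last visit to `v`, a walk stays in `X \ {v}`. -/
theorem reach_subset_insert (T : V → V → Prop) (X : Set V) (v : V) :
    reach T X v ⊆ insert v (⋃ u ∈ {u | T v u ∧ u ∈ X \ {v}}, reach T (X \ {v}) u) := by
  intro w hw
  induction hw with
  | refl => exact mem_insert _ _
  | @tail a b _ hab ih =>
    by_cases hb : b = v
    · exact Or.inl hb
    right
    rcases ih with rfl | ih
    · exact mem_biUnion (show b ∈ {u | T a u ∧ u ∈ X \ {a}} from ⟨hab.1, hab.2, hb⟩)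
        (mem_reach_self _ _ _)
    · obtain ⟨u, hu, ha⟩ := mem_iUnion₂.1 ih
      exact mem_biUnion hu (Relation.ReflTransGen.tail ha ⟨hab.1, hab.2, hb⟩)

theorem reach_eq_of_mem {X : Set V} {v w : V} (hv : v ∈ X) (hw : w ∈ reach G.Adj X v) :
    reach G.Adj X w = reach G.Adj X v := by
  have hsymm : ∀ {a b}, a ∈ X → b ∈ reach G.Adj X a → a ∈ reach G.Adj X b := by
    intro a b ha hb
    induction hb with
    | refl => exact mem_reach_self _ _ _
    | tail h hab ih => exact Relation.ReflTransGen.head ⟨hab.1.symm, reach_subset _ ha h⟩ ih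
  ext z
  exact ⟨fun hz ↦ Relation.ReflTransGen.trans hw hz,
    fun hz ↦ Relation.ReflTransGen.trans (hsymm hv hw) hz⟩

/-- A version of König's infinity lemma for a regular cardinal `c`, the classical case being
`c = ℵ₀`. -/
theorem IsRayless.mk_reach_lt (hG : G.IsRayless) {c : Cardinal.{u}} (hc : c.IsRegular)
    {T : V → V → Prop} (hT : ∀ a b, T a b → G.Adj a b) (hdeg : ∀ a, #{b | T a b} < c)
    (X : Set V) (v : V) : #(reach T X v) < c := by
  -- The reachable set is a union of fewer than `c` sets that are smaller than `c` by induction.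
  suffices h : ∀ p : Set V × V, #(reach T p.1 p.2) < c from h (X, v)
  intro p
  induction p using hG.wellFounded_pathStep.induction with
  | _ p ih =>
    refine (mk_le_mk_of_subset (reach_subset_insert T p.1 p.2)).trans_lt ?_
    refine mk_insert_le.trans_lt (add_lt_of_lt hc.aleph0_le ?_ (one_lt_aleph0.trans_le hc.aleph0_le))
    refine (card_biUnion_lt_iff_forall_of_isRegular hc
      ((mk_le_mk_of_subset fun u hu ↦ hu.1).trans_lt (hdeg p.2))).2 fun u hu ↦ ?_
    exact ih (p.1 \ {p.2}, u) ⟨rfl, hu.2, hT _ _ hu.1⟩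

/-- The set `W` consists of the vertices reachable from `U` through vertices of degree less than
`c`. Recolouring the vertices of degree less than `c` in `W` cannot affect a vertex of degree less
than `c` outside `W`. -/
theorem IsRayless.exists_closed_superset (hG : G.IsRayless) {c : Cardinal.{u}} (hc : c.IsRegular)
    {U : Set V} (hU : #U < c) :
    ∃ W : Set V, U ⊆ W ∧ #W < c ∧
      ∀ w ∈ W, #(G.neighborSet w) < c → ∀ y, G.Adj w y → y ∈ W := by
  let T : V → V → Prop := fun a b ↦ G.Adj a b ∧ #(G.neighborSet a) < c
  refine ⟨⋃ u ∈ U, reach T univ u, fun u hu ↦ mem_biUnion hu (mem_reach_self _ _ _), ?_, ?_⟩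
  · refine (card_biUnion_lt_iff_forall_of_isRegular hc hU).2 fun u _ ↦
      hG.mk_reach_lt hc (fun _ _ h ↦ h.1) (fun a ↦ ?_) _ _
    by_cases ha : #(G.neighborSet a) < c
    · exact (mk_le_mk_of_subset fun b hb ↦ hb.1).trans_lt ha
    · simpa [T, ha] using hc.pos
  · intro w hw hdeg y hy
    obtain ⟨u, hu, hw⟩ := mem_iUnion₂.1 hw
    exact mem_biUnion hu (Relation.ReflTransGen.tail hw ⟨⟨hy, hdeg⟩, mem_univ _⟩)

/-! ### Happiness under recolouring -/

theorem IsHappy.mono {π π' : V → Fin 2} {x : V} (h : G.IsHappy π x)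
    (hf : G.friends π' x ⊆ G.friends π x) (ho : G.opponents π x ⊆ G.opponents π' x) :
    G.IsHappy π' x :=
  (mk_le_mk_of_subset hf).trans (h.trans (mk_le_mk_of_subset ho))

theorem IsHappy.congr {π π' : V → Fin 2} {x : V} (h : G.IsHappy π x) (hx : π' x = π x)
    (hn : ∀ y, G.Adj x y → π' y = π y) : G.IsHappy π' x := by
  refine h.mono (fun y hy ↦ ⟨hy.1, ?_⟩) (fun y hy ↦ ⟨hy.1, ?_⟩)
  · rw [← hn y hy.1, ← hx]; exact hy.2
  · rw [hn y hy.1, hx]; exact hy.2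

theorem friends_union_opponents (π : V → Fin 2) (x : V) :
    G.friends π x ∪ G.opponents π x = G.neighborSet x := by
  ext y
  simp only [friends, opponents, mem_union, mem_ofPred_eq, mem_neighborSet]
  tauto

/-- The larger of two sets with an infinite union has the size of the union. -/
theorem mk_eq_of_union_eq {S O N : Set V} (h : S ∪ O = N) (hle : #S ≤ #O) (hN : ℵ₀ ≤ #N) :
    #O = #N := by
  have h1 : #N ≤ #O + #O := h ▸ (mk_union_le S O).trans (add_le_add_left hle _)
  have h2 : ℵ₀ ≤ #O := by
    by_contra! h2
    exact (hN.trans h1).not_gt (add_lt_aleph0 h2 h2)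
  exact (mk_le_mk_of_subset (h ▸ subset_union_right)).antisymm (h1.trans (add_eq_self h2).le)

/-- A vertex of infinite degree is happy as soon as its opponents include all but a few elements
of a set of full size. -/
theorem isHappy_of_diff_subset {π : V → Fin 2} {x : V} {O Z : Set V}
    (hN : ℵ₀ ≤ #(G.neighborSet x)) (hO : #O = #(G.neighborSet x))
    (hZ : #Z < #(G.neighborSet x)) (h : O \ Z ⊆ G.opponents π x) : G.IsHappy π x := by
  have h1 : #O ≤ #(O \ Z : Set V) + #Z :=
    (mk_le_mk_of_subset (by rw [sdiff_union_self]; exact subset_union_left)).trans (mk_union_le _ _)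
  have h2 : #(G.neighborSet x) ≤ #(O \ Z : Set V) := by
    by_contra! h2
    exact (hO ▸ h1).not_gt (add_lt_of_lt hN h2 hZ)
  exact (mk_le_mk_of_subset fun y hy ↦ hy.1).trans (h2.trans (mk_le_mk_of_subset h))

/-- A happy vertex of infinite degree stays happy if fewer vertices than its degree change. -/
theorem IsHappy.of_small_change {π π' : V → Fin 2} {x : V} {Z : Set V} (h : G.IsHappy π x)
    (hN : ℵ₀ ≤ #(G.neighborSet x)) (hZ : #Z < #(G.neighborSet x)) (hx : π' x = π x)
    (hd : ∀ y ∉ Z, π' y = π y) : G.IsHappy π' x := by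
  refine isHappy_of_diff_subset hN (mk_eq_of_union_eq (friends_union_opponents π x) h hN) hZ ?_
  rintro y ⟨hy, hyZ⟩
  exact ⟨hy.1, by rw [hd y hyZ, hx]; exact hy.2⟩

/-- Finitely many vertices of finite degree can be recoloured so that all of them are happy: the
number of monochromatic edges meeting them has a minimum, and recolouring an unhappy vertex would
decrease it. -/
theorem exists_isHappy_of_finite {A : Set V} (hA : A.Finite)
    (hdeg : ∀ a ∈ A, (G.neighborSet a).Finite) (σ : V → Fin 2) :
    ∃ π : V → Fin 2, (∀ w ∉ A, π w = σ w) ∧ ∀ a ∈ A, G.IsHappy π a := by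
  classical
  let M : (V → Fin 2) → Set (Sym2 V) := fun π ↦
    {e | ∃ a ∈ A, ∃ b, e = s(a, b) ∧ G.Adj a b ∧ π a = π b}
  have hM : ∀ π, (M π).Finite := fun π ↦ by
    refine (hA.biUnion fun a ha ↦ (hdeg a ha).image fun b ↦ s(a, b)).subset ?_
    rintro e ⟨a, ha, b, rfl, hab, -⟩
    exact mem_biUnion ha ⟨b, hab, rfl⟩
  obtain ⟨π, hπ, hmin⟩ := (measure fun π ↦ (M π).ncard).wf.has_min
    {π : V → Fin 2 | ∀ w ∉ A, π w = σ w} ⟨σ, fun _ _ ↦ rfl⟩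
  refine ⟨π, hπ, fun x hx ↦ ?_⟩
  by_contra hun
  have hf : (G.friends π x).Finite := (hdeg x hx).subset fun y hy ↦ hy.1
  have ho : (G.opponents π x).Finite := (hdeg x hx).subset fun y hy ↦ hy.1
  have hlt : (G.opponents π x).ncard < (G.friends π x).ncard := by
    rw [IsHappy, not_le, ← cast_ncard hf, ← cast_ncard ho] at hun
    exact_mod_cast hun
  let π' := Function.update π x (π x + 1)
  have hx' : π' x ≠ π x := by simp [π']
  have hne : ∀ y, y ≠ x → π' y = π y := fun y hy ↦ by simp [π', hy]
  refine hmin π' (fun w hw ↦ ?_) ?_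
  · rw [hne w (by rintro rfl; exact hw hx)]
    exact hπ w hw
  -- Only edges at `x` are affected by the change: it removes those to friends of `x` from `M π`
  -- and adds those to opponents.
  let R : Set (Sym2 V) := {e ∈ M π | x ∉ e}
  have hR : R.Finite := (hM π).subset fun e he ↦ he.1
  have h1 : M π' ⊆ R ∪ (fun b ↦ s(x, b)) '' G.opponents π x := by
    rintro e ⟨a, ha, b, rfl, hab, hπab⟩
    by_cases hax : a = x
    · subst hax
      rw [hne b hab.ne'] at hπab
      exact Or.inr ⟨b, ⟨hab, fun h ↦ hx' (hπab.trans h)⟩, rfl⟩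
    by_cases hbx : b = x
    · subst hbx
      rw [hne a hax] at hπab
      exact Or.inr ⟨a, ⟨hab.symm, fun h ↦ hx' (hπab.symm.trans h)⟩, Sym2.eq_swap⟩
    refine Or.inl ⟨⟨a, ha, b, rfl, hab, by rwa [hne a hax, hne b hbx] at hπab⟩, ?_⟩
    rw [Sym2.mem_iff]
    rintro (h | h)
    exacts [hax h.symm, hbx h.symm]
  have h2 : R ∪ (fun b ↦ s(x, b)) '' G.friends π x ⊆ M π := by
    rintro e (he | ⟨b, hb, rfl⟩)
    · exact he.1
    · exact ⟨x, hx, b, rfl, hb.1, hb.2.symm⟩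
  have hdisj : Disjoint R ((fun b ↦ s(x, b)) '' G.friends π x) := by
    rw [Set.disjoint_left]
    rintro e he ⟨b, -, rfl⟩
    exact he.2 (Sym2.mem_mk_left x b)
  calc (M π').ncard ≤ R.ncard + (G.opponents π x).ncard :=
        (ncard_le_ncard h1 (hR.union (ho.image _))).trans
          ((ncard_union_le _ _).trans (Nat.add_le_add_left (ncard_image_le ho) _))
    _ < R.ncard + (G.friends π x).ncard := Nat.add_lt_add_left hlt _
    _ = (R ∪ (fun b ↦ s(x, b)) '' G.friends π x).ncard := by
        rw [ncard_union_eq hdisj hR (hf.image _),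
          ncard_image_of_injective _ fun a b h ↦ Sym2.congr_right.1 h]
    _ ≤ (M π).ncard := ncard_le_ncard h2 (hM π)

/-! ### Adjustable sets -/

/-- A set `B` of vertices is adjustable if, for every colouring of the graph and every subset `A`
of `B`, the vertices of `A` can be recoloured, those outside `A` keeping their colours, in such a
way that all vertices of `A` are happy. -/
def IsAdjustable (G : SimpleGraph V) (B : Set V) : Prop :=
  ∀ (σ : V → Fin 2) (A : Set V), A ⊆ B →
    ∃ π : V → Fin 2, (∀ w ∉ A, π w = σ w) ∧ ∀ y ∈ A, G.IsHappy π y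

theorem IsAdjustable.mono {B C : Set V} (hC : G.IsAdjustable C) (h : B ⊆ C) : G.IsAdjustable B :=
  fun σ A hA ↦ hC σ A (hA.trans h)

/-- The components of `G[X]` can be adjusted independently of each other. -/
theorem isAdjustable_of_reach {X B : Set V} (hB : B ⊆ X)
    (h : ∀ y ∈ B, G.IsAdjustable (reach G.Adj X y)) : G.IsAdjustable B := by
  classical
  intro σ A hA
  -- The new colouring is chosen for the component as a set, so that all its vertices share it.
  have h' : ∀ C : Set V, ∃ π : V → Fin 2, (∃ y ∈ B, C = reach G.Adj X y) →
      (∀ w ∉ A ∩ C, π w = σ w) ∧ ∀ y ∈ A ∩ C, G.IsHappy π y := by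
    intro C
    by_cases hC : ∃ y ∈ B, C = reach G.Adj X y
    · obtain ⟨y, hy, rfl⟩ := hC
      obtain ⟨π, hπ⟩ := h y hy σ (A ∩ reach G.Adj X y) inter_subset_right
      exact ⟨π, fun _ ↦ hπ⟩
    · exact ⟨σ, fun h ↦ (hC h).elim⟩
  choose f hf using h'
  refine ⟨fun w ↦ if w ∈ A then f (reach G.Adj X w) w else σ w, fun w hw ↦ if_neg hw, ?_⟩
  intro y hy
  obtain ⟨h1, h2⟩ := hf (reach G.Adj X y) ⟨y, hA hy, rfl⟩
  refine (h2 y ⟨hy, mem_reach_self _ _ _⟩).congr (if_pos hy) fun z hz ↦ ?_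
  by_cases hzA : z ∈ A
  · have hzy : z ∈ reach G.Adj X y := Relation.ReflTransGen.single ⟨hz, hB (hA hzA)⟩
    simp only [if_pos hzA]
    rw [reach_eq_of_mem (hB (hA hy)) hzy]
  · simp only [if_neg hzA]
    exact (h1 z fun h ↦ hzA h.1).symm

/-- There is a regular cardinal above `l` that no infinite cardinal exceeding `l` falls short of:
`ℵ₀` if `l` is finite, and the successor of `l` otherwise. -/
theorem exists_isRegular_threshold (l : Cardinal.{u}) :
    ∃ c : Cardinal.{u}, c.IsRegular ∧ l < c ∧ ∀ k, ℵ₀ ≤ k → l < k → c ≤ k := by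
  rcases lt_or_ge l ℵ₀ with h | h
  · exact ⟨ℵ₀, isRegular_aleph0, h, fun k hk _ ↦ hk⟩
  · exact ⟨Order.succ l, isRegular_succ h, Order.lt_succ l, fun k _ hk ↦ Order.succ_le_of_lt hk⟩

/-- The induction step: adding one vertex preserves adjustability. If the new vertex `v` is
unhappy, it is switched (or, if its degree is finite, recoloured along with nearby vertices), and
the change is confined to a set that is small compared with the large degrees. -/
theorem IsRayless.isAdjustable_insert (hG : G.IsRayless) {B : Set V} (hB : G.IsAdjustable B)
    (v : V) : G.IsAdjustable (insert v B) := by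
  classical
  intro σ A hA
  have hA' : A \ {v} ⊆ B := fun w hw ↦ (hA hw.1).resolve_left hw.2
  by_cases hvA : v ∈ A
  swap
  · exact hB σ A fun w hw ↦ hA' ⟨hw, by rintro rfl; exact hvA hw⟩
  obtain ⟨π, hπσ, hπ⟩ := hB σ (A \ {v}) hA'
  have hπσ' : ∀ w ∉ A, π w = σ w := fun w hw ↦ hπσ w fun h ↦ hw h.1
  rcases lt_or_ge #(G.neighborSet v) ℵ₀ with hfin | hinf
  · -- `E` is closed under neighbours of finite degree in `A`, so a cut optimal on `E` will do.
    obtain ⟨W, hvW, hW, hcl⟩ := hG.exists_closed_superset isRegular_aleph0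
      (U := {v}) (by simp)
    let E : Set V := {w ∈ A ∩ W | #(G.neighborSet w) < ℵ₀}
    have hE : #E < ℵ₀ := (mk_le_mk_of_subset fun w hw ↦ hw.1.2).trans_lt hW
    have hvE : v ∈ E := ⟨⟨hvA, hvW rfl⟩, hfin⟩
    obtain ⟨π', hπ', hhap⟩ := G.exists_isHappy_of_finite (lt_aleph0_iff_set_finite.1 hE)
      (fun a ha ↦ lt_aleph0_iff_set_finite.1 ha.2) π
    refine ⟨π', fun w hw ↦ (hπ' w fun h ↦ hw h.1.1).trans (hπσ' w hw), fun y hy ↦ ?_⟩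
    by_cases hyE : y ∈ E
    · exact hhap y hyE
    have hyπ : G.IsHappy π y := hπ y ⟨hy, by rintro rfl; exact hyE hvE⟩
    rcases lt_or_ge #(G.neighborSet y) ℵ₀ with hdy | hdy
    · refine hyπ.congr (hπ' y hyE) fun z hz ↦ hπ' z fun hzE ↦ ?_
      exact hyE ⟨⟨hy, hcl z hzE.1.2 hzE.2 y hz.symm⟩, hdy⟩
    · exact hyπ.of_small_change hdy (hE.trans_le hdy) (hπ' y hyE) hπ'
  by_cases hv : G.IsHappy π v
  · refine ⟨π, hπσ', fun y hy ↦ ?_⟩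
    by_cases hyv : y = v
    · exact hyv ▸ hv
    · exact hπ y ⟨hy, hyv⟩
  -- Now `v` has infinite degree and is unhappy: its friends are as many as its neighbours.
  rw [IsHappy, not_le] at hv
  have hfr : #(G.friends π v) = #(G.neighborSet v) :=
    mk_eq_of_union_eq ((union_comm _ _).trans (friends_union_opponents π v)) hv.le hinf
  obtain ⟨c, hc, hoc, hcle⟩ := exists_isRegular_threshold #(G.opponents π v)
  have hcv : c ≤ #(G.neighborSet v) := hcle _ hinf (hfr ▸ hv)
  obtain ⟨W, hUW, hW, hcl⟩ := hG.exists_closed_superset hc hoc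
  -- `E` is the set to be readjusted once `v` has been switched.
  let E : Set V := {w ∈ A ∩ W | #(G.neighborSet w) < c}
  have hE : #E < c := (mk_le_mk_of_subset fun w hw ↦ hw.1.2).trans_lt hW
  have hvE : v ∉ E := fun h ↦ hcv.not_gt h.2
  obtain ⟨π', hπ', hhap⟩ := hB (Function.update π v (π v + 1)) E
    fun w hw ↦ hA' ⟨hw.1.1, by rintro rfl; exact hvE hw⟩
  have hπ'v : π' v ≠ π v := by simp [hπ' v hvE]
  have hne : ∀ w, w ∉ E → w ≠ v → π' w = π w := fun w hw hwv ↦ by simp [hπ' w hw, hwv]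
  refine ⟨π', fun w hw ↦ ?_, fun y hy ↦ ?_⟩
  · exact (hne w (fun h ↦ hw h.1.1) (by rintro rfl; exact hw hvA)).trans (hπσ' w hw)
  by_cases hyE : y ∈ E
  · exact hhap y hyE
  by_cases hyv : y = v
  · -- The former friends of `v` outside `E` are now its opponents.
    subst hyv
    refine isHappy_of_diff_subset hinf hfr (hE.trans_le hcv) ?_
    rintro z ⟨hz, hzE⟩
    refine ⟨hz.1, ?_⟩
    rw [hne z hzE hz.1.ne', hz.2]
    exact hπ'v.symm
  have hyπ : G.IsHappy π y := hπ y ⟨hy, hyv⟩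
  rcases lt_or_ge #(G.neighborSet y) c with hdy | hdy
  · -- A vertex of small degree outside `E` sees no change, except that `v` may turn from a friend
    -- into an opponent.
    have hyW : y ∉ W := fun h ↦ hyE ⟨⟨hy, h⟩, hdy⟩
    have hnE : ∀ z, G.Adj y z → z ∉ E := fun z hz h ↦ hyW (hcl z h.1.2 h.2 y hz.symm)
    have hyv' : G.Adj y v → π y = π v := fun h ↦ by
      by_contra hne
      exact hyW (hUW ⟨h.symm, hne⟩)
    refine hyπ.mono ?_ ?_
    · rintro z ⟨hz, hzy⟩
      rw [hne y hyE hyv] at hzy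
      by_cases hzv : z = v
      · subst hzv
        exact absurd (hzy.trans (hyv' hz)) hπ'v
      · exact ⟨hz, by rwa [hne z (hnE z hz) hzv] at hzy⟩
    · rintro z ⟨hz, hzy⟩
      have hzv : z ≠ v := by
        rintro rfl
        exact hzy (hyv' hz).symm
      exact ⟨hz, by rwa [hne z (hnE z hz) hzv, hne y hyE hyv]⟩
  · -- A vertex of large degree stays happy, as fewer than `c` vertices change.
    have hinsert : #(insert v E : Set V) < c :=
      mk_insert_le.trans_lt (add_lt_of_lt hc.aleph0_le hE (one_lt_aleph0.trans_le hc.aleph0_le))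
    refine hyπ.of_small_change (hc.aleph0_le.trans hdy) (hinsert.trans_le hdy) (hne y hyE hyv)
      fun z hz ↦ ?_
    rw [mem_insert_iff, not_or] at hz
    exact hne z hz.2 hz.1

theorem IsRayless.isAdjustable_reach (hG : G.IsRayless) (X : Set V) (v : V) :
    G.IsAdjustable (reach G.Adj X v) := by
  suffices h : ∀ p : Set V × V, G.IsAdjustable (reach G.Adj p.1 p.2) from h (X, v)
  intro p
  induction p using hG.wellFounded_pathStep.induction with
  | _ p ih =>
    refine (hG.isAdjustable_insert (isAdjustable_of_reach (X := p.1 \ {p.2}) ?_ ?_) p.2).mono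
      (reach_subset_insert G.Adj p.1 p.2)
    · exact iUnion₂_subset fun u hu ↦ reach_subset _ hu.2
    · intro y hy
      obtain ⟨u, hu, hyu⟩ := mem_iUnion₂.1 hy
      rw [reach_eq_of_mem hu.2 hyu]
      exact ih (p.1 \ {p.2}, u) ⟨rfl, hu.2, hu.1⟩

theorem IsRayless.isAdjustable_univ (hG : G.IsRayless) : G.IsAdjustable univ :=
  isAdjustable_of_reach subset_rfl fun y _ ↦ hG.isAdjustable_reach univ y

end SimpleGraph

theorem mainTheorem1 {V : Type*} (G : SimpleGraph V) (hG : G.IsRayless) :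
    ∃ π : V → Fin 2, G.IsUnfriendly π := by
  obtain ⟨π, -, hπ⟩ := hG.isAdjustable_univ (fun _ ↦ 0) Set.univ subset_rfl
  exact ⟨π, fun x ↦ hπ x (Set.mem_univ x)⟩
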